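/- Let $k$ be an infinite field. A $k$-algebra means a $k$-vector space with a $k$-bilinear multiplication, not assumed associative, commutative or unital; for such an algebra $B$ put $Z(B)=\{x\in B : xB=Bx=\{0\}\}$. Let $(A_i)_{i\in I}$ be a family of $k$-algebras, $B$ a $k$-algebra, and $f:A=\prod_{i\in I}A_i\to B$ a surjective $k$-algebra homomorphism. Suppose that either (i) $\dim_k(B)<\operatorname{card}(k)$, or (ii) $\dim_k(B)<2^{\aleph_0}$. Then the composite homomorphism $A\to B\to B/Z(B)$ can be factored as a composite of $k$-algebra homomorphisms $$A\to A/\mathcal U_0\times\dots\times A/\mathcal U_{n-1}\to B/Z(B)\qquad(n\in\omega),$$ where the $\mathcal U_m$ are ultrafilters on $I$, the first map is the product of the quotient maps onto the ultraproducts $A/\mathcal U_m$ (in which $(a_i)\sim(b_i)$ iff $\{i : a_i=b_i\}\in\mathcal U_m$), and the $\mathcal U_m$ are $\operatorname{card}(k)^+$-complete in case (i), and countably complete in case (ii). (A filter is $\kappa$-complete if it is closed under intersections of families of fewer than $\kappa$ members; countably complete means $\aleph_1$-complete.) Call an infinite cardinal $\kappa$ measurable if there is a nonprincipal $\kappa$-complete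 ultrafilter on $\kappa$ (so $\aleph_0$ counts as measurable). If $\operatorname{card}(I)$ is less than every measurable cardinal $>\operatorname{card}(k)$ in case (i), or less than every uncountable measurable cardinal in case (ii) (in particular, in either case, if no such measurable cardinals exist), then $A\to B\to B/Z(B)$ factors through the projection of $A$ onto a finite subproduct $A_{i_0}\times\dots\times A_{i_{n-1}}$ ($i_0,\dots,i_{n-1}\in I$). In that situation, $f=f_1+f_0$, where $f_1:A\to B$ is a $k$-algebra homomorphism that factors through the projection of $A$ onto that same finite subproduct, and $f_0:A\to B$ is a $k$-algebra homomorphism with image in $Z(B)$. -/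

import Mathlib

open Cardinal

universe u v w a

section Algebras

/-!
Throughout, a `k`-algebra is a `k`-module with a `k`-bilinear multiplication, not assumed
associative, commutative or unital: `NonUnitalNonAssocRing`, `Module`, `IsScalarTower`,
`SMulCommClass`. Homomorphisms of such algebras are `A →ₙₐ[k] B`.
-/

/-- A two-sided ideal of a `k`-algebra: a `k`-submodule absorbing multiplication on both sides. -/
structure AlgIdeal (k : Type v) (A : Type w) [CommRing k] [NonUnitalNonAssocRing A] [Module k A]
    extends Submodule k A where
  mul_mem_left : ∀ (x : A) {y : A}, y ∈ carrier → x * y ∈ carrier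
  mul_mem_right : ∀ {x : A} (y : A), x ∈ carrier → x * y ∈ carrier

namespace AlgIdeal

variable {k : Type v} {A : Type w} [CommRing k] [NonUnitalNonAssocRing A] [Module k A]

/-- The quotient of a `k`-algebra by a two-sided ideal. -/
def Quotient (Z : AlgIdeal k A) : Type w := A ⧸ Z.toSubmodule

instance (Z : AlgIdeal k A) : AddCommGroup Z.Quotient :=
  inferInstanceAs (AddCommGroup (A ⧸ Z.toSubmodule))

instance (Z : AlgIdeal k A) : Module k Z.Quotient :=
  inferInstanceAs (Module k (A ⧸ Z.toSubmodule))

/-- The class of an element in the quotient algebra. -/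
def cls (Z : AlgIdeal k A) (x : A) : Z.Quotient := Z.toSubmodule.mkQ x

theorem cls_surjective (Z : AlgIdeal k A) : Function.Surjective Z.cls :=
  Z.toSubmodule.mkQ_surjective

theorem cls_eq_iff (Z : AlgIdeal k A) {x y : A} : Z.cls x = Z.cls y ↔ x - y ∈ Z.toSubmodule :=
  Submodule.Quotient.eq Z.toSubmodule

theorem cls_add (Z : AlgIdeal k A) (x y : A) : Z.cls (x + y) = Z.cls x + Z.cls y := rfl

theorem cls_smul (Z : AlgIdeal k A) (c : k) (x : A) : Z.cls (c • x) = c • Z.cls x := rfl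

instance (Z : AlgIdeal k A) : Mul Z.Quotient :=
  ⟨Quotient.map₂ (· * ·) (by
    intro x x' hx y y' hy
    have hx' : x - x' ∈ Z.toSubmodule := (Submodule.quotientRel_def _).mp hx
    have hy' : y - y' ∈ Z.toSubmodule := (Submodule.quotientRel_def _).mp hy
    refine (Submodule.quotientRel_def _).mpr ?_
    have h : x * y - x' * y' = (x - x') * y + x' * (y - y') := by
      rw [sub_mul, mul_sub]; abel
    rw [h]
    exact Z.toSubmodule.add_mem (Z.mul_mem_right y hx') (Z.mul_mem_left x' hy'))⟩

theorem cls_mul (Z : AlgIdeal k A) (x y : A) : Z.cls (x * y) = Z.cls x * Z.cls y := rfl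

instance (Z : AlgIdeal k A) : NonUnitalNonAssocRing Z.Quotient :=
  { (inferInstance : AddCommGroup Z.Quotient), (inferInstance : Mul Z.Quotient) with
    left_distrib := by
      intro p q r
      obtain ⟨x, rfl⟩ := Z.cls_surjective p
      obtain ⟨y, rfl⟩ := Z.cls_surjective q
      obtain ⟨z, rfl⟩ := Z.cls_surjective r
      exact congrArg Z.cls (mul_add x y z)
    right_distrib := by
      intro p q r
      obtain ⟨x, rfl⟩ := Z.cls_surjective p
      obtain ⟨y, rfl⟩ := Z.cls_surjective q
      obtain ⟨z, rfl⟩ := Z.cls_surjective r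
      exact congrArg Z.cls (add_mul x y z)
    zero_mul := by
      intro p
      obtain ⟨x, rfl⟩ := Z.cls_surjective p
      exact congrArg Z.cls (zero_mul x)
    mul_zero := by
      intro p
      obtain ⟨x, rfl⟩ := Z.cls_surjective p
      exact congrArg Z.cls (mul_zero x) }

instance (Z : AlgIdeal k A) [IsScalarTower k A A] : IsScalarTower k Z.Quotient Z.Quotient where
  smul_assoc := by
    intro c p q
    obtain ⟨x, rfl⟩ := Z.cls_surjective p
    obtain ⟨y, rfl⟩ := Z.cls_surjective q
    exact congrArg Z.cls (smul_mul_assoc c x y)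

instance (Z : AlgIdeal k A) [SMulCommClass k A A] : SMulCommClass k Z.Quotient Z.Quotient where
  smul_comm := by
    intro c p q
    obtain ⟨x, rfl⟩ := Z.cls_surjective p
    obtain ⟨y, rfl⟩ := Z.cls_surjective q
    exact congrArg Z.cls (mul_smul_comm c x y).symm

/-- The quotient homomorphism of `k`-algebras. -/
def mkHom (Z : AlgIdeal k A) : A →ₙₐ[k] Z.Quotient where
  toFun := Z.cls
  map_smul' := Z.cls_smul
  map_zero' := rfl
  map_add' := Z.cls_add
  map_mul' := Z.cls_mul

end AlgIdeal

/-- The total annihilator ideal `Z(B) = {x | xB = Bx = 0}`. -/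
def totalAnnihilator (k : Type v) (B : Type w) [CommRing k] [NonUnitalNonAssocRing B] [Module k B]
    [IsScalarTower k B B] [SMulCommClass k B B] : AlgIdeal k B where
  carrier := {x | ∀ y : B, x * y = 0 ∧ y * x = 0}
  add_mem' := by
    intro x x' hx hx' y
    simp [add_mul, mul_add, hx y, hx' y]
  zero_mem' := by intro y; simp
  smul_mem' := by
    intro c x hx y
    simp [smul_mul_assoc, mul_smul_comm, hx y]
  mul_mem_left := by
    intro x y hy z
    simp [(hy x).2]
  mul_mem_right := by
    intro x y hx z
    simp [(hx y).1]

/-- The ideal of those elements of `∏ A_i` that vanish at `F`-almost all indices. -/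
def reducedIdeal (k : Type v) {I : Type u} (A : I → Type a) [CommRing k]
    [∀ i, NonUnitalNonAssocRing (A i)] [∀ i, Module k (A i)] (F : Filter I) :
    AlgIdeal k (∀ i, A i) where
  carrier := {x | ∀ᶠ i in F, x i = 0}
  add_mem' := by
    intro x y hx hy
    filter_upwards [hx, hy] with i h h'
    simp [h, h']
  zero_mem' := Filter.Eventually.of_forall fun _ => rfl
  smul_mem' := by
    intro c x hx
    filter_upwards [hx] with i h
    simp [h]
  mul_mem_left := by
    intro x y hy
    filter_upwards [hy] with i h
    simp [h]
  mul_mem_right := by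
    intro x y hx
    filter_upwards [hx] with i h
    simp [h]

/-- The reduced product `(∏ A_i) / F`; for `F` an ultrafilter, the ultraproduct. -/
abbrev ReducedProduct (k : Type v) {I : Type u} (A : I → Type a) [CommRing k]
    [∀ i, NonUnitalNonAssocRing (A i)] [∀ i, Module k (A i)] (F : Filter I) : Type (max u a) :=
  (reducedIdeal k A F).Quotient

/-- Two families are identified in the reduced product iff they agree on a member of `F`. -/
theorem reducedIdeal_mk_eq_iff (k : Type v) {I : Type u} (A : I → Type a) [CommRing k]
    [∀ i, NonUnitalNonAssocRing (A i)] [∀ i, Module k (A i)] (F : Filter I) (x y : ∀ i, A i) :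
    (reducedIdeal k A F).mkHom x = (reducedIdeal k A F).mkHom y ↔ {i | x i = y i} ∈ F := by
  refine (AlgIdeal.cls_eq_iff _).trans ?_
  change (∀ᶠ i in F, (x - y) i = 0) ↔ ∀ᶠ i in F, x i = y i
  simp [sub_eq_zero]

end Algebras

section Completeness

/-- A filter is `κ`-complete if it is closed under intersections of fewer than `κ` members.
The set and the cardinal may live in different universes. -/
def IsCompleteFilter {I : Type u} (F : Filter I) (κ : Cardinal.{v}) : Prop :=
  ∀ S : Set (Set I), lift.{v} #S < lift.{u} κ → (∀ J ∈ S, J ∈ F) → ⋂₀ S ∈ F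

/-- An infinite cardinal `κ` is measurable if there is a nonprincipal `κ`-complete ultrafilter
on `κ`. With this convention `ℵ₀` is measurable. -/
def IsMeasurableCardinal (κ : Cardinal.{u}) : Prop :=
  ℵ₀ ≤ κ ∧ ∃ U : Ultrafilter κ.out, (∀ x : κ.out, U ≠ pure x) ∧ IsCompleteFilter (U : Filter κ.out) κ

end Completeness

section Factorizations

variable {k : Type v} {I : Type u} {A : I → Type a} {B : Type w} [CommRing k]
  [∀ i, NonUnitalNonAssocRing (A i)] [∀ i, Module k (A i)]
  [NonUnitalNonAssocRing B] [Module k B]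

/-- The homomorphism `h` on `A = ∏ A_i` factors, as a `k`-algebra homomorphism, as
`A → A/U_0 × ⋯ × A/U_{n-1} → B` for finitely many `κ`-complete ultrafilters `U_m`. -/
def FactorsThroughUltraproducts (h : (∀ i, A i) →ₙₐ[k] B) (κ : Cardinal.{v}) : Prop :=
  ∃ (n : ℕ) (U : Fin n → Ultrafilter I),
    (∀ m, IsCompleteFilter (U m : Filter I) κ) ∧
    ∃ g : (∀ m : Fin n, ReducedProduct k A (U m : Filter I)) →ₙₐ[k] B,
      ∀ x : ∀ i, A i, h x = g fun m => (reducedIdeal k A (U m : Filter I)).mkHom x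

/-- The homomorphism `h` on `∏ A_i` factors, as a `k`-algebra homomorphism, through the
projection to the subproduct indexed by the finite set `s`. -/
def FactorsThroughSubproduct (h : (∀ i, A i) →ₙₐ[k] B) (s : Finset I) : Prop :=
  ∃ g : (∀ i : s, A i) →ₙₐ[k] B, ∀ x : ∀ i, A i, h x = g fun i => x i

end Factorizations

/-!
If `f` kills `u • y` for some `u : I → k`, then it maps into `Z(B)` the part of `y` supported where
`u ≠ 0`, because there the factor `u` can be moved to the other factor of a product and inverted.
Hence, given `c : I → C`, the linear map `(C → k) → B`, `u ↦ f ((u ∘ c) • y)`, should kill some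
`u` with only finitely many zeros. For `C = k` and `dim B < card k`, a combination of the functions
`x ↦ (x - α)⁻¹` does this; for `C = ℕ` and `dim B < 2 ^ ℵ₀`, either the same argument applies or
`B` has fewer than `2 ^ ℵ₀` elements, and one of `2 ^ ℵ₀` pairwise almost disjoint functions minus
another does.

It follows that, modulo the filter of those `J ⊆ I` on which the homomorphism `A → B/Z(B)` is
supported, every function `I → C` takes finitely many values. So there are only finitely many
ultrafilters finer than this filter, all of them `(card C)⁺`-complete. They are principal if
`card I` is too small for a measurable cardinal, since a nonprincipal ultrafilter makes the least
size of a family of its members with intersection outside of it a measurable cardinal.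
-/

section Cardinality

theorem lift_mk_le_max_rank (R : Type v) (M : Type w) [Ring R] [StrongRankCondition R] [Infinite R]
    [AddCommGroup M] [Module R M] [Module.Free R M] :
    lift.{v} #M ≤ max (lift.{v} (Module.rank R M)) (lift.{w} #R) := by
  rcases subsingleton_or_nontrivial M with hM | hM
  · exact (lift_le_one_iff.2 (le_one_iff_subsingleton.2 hM)).trans
      (le_max_of_le_right (one_le_lift_iff.2 (Cardinal.one_le_iff_ne_zero.2 (mk_ne_zero R))))
  · let b := Module.Free.chooseBasis R M
    have : Nonempty (Module.Free.ChooseBasisIndex R M) := b.index_nonempty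
    have h := lift_mk_eq'.2 ⟨b.repr.toEquiv⟩
    rw [mk_finsupp_lift_of_infinite', ← Module.Free.rank_eq_card_chooseBasisIndex,
      lift_umax.{w, v}, lift_max, lift_lift, lift_lift, lift_umax.{w, v}] at h
    exact h.le

theorem exists_pairwise_finite_setOf_eq (E : Type*) [Infinite E] :
    ∃ e : (ℕ → Bool) → ℕ → E, Pairwise fun r s => {n | e r n = e s n}.Finite := by
  -- Encode the branches of the binary tree: distinct branches share only finitely many nodes.
  let φ : List Bool ↪ E := (Encodable.encode' (List Bool)).trans (Infinite.natEmbedding E)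
  refine ⟨fun r n => φ ((List.range n).map r), fun r s hrs => ?_⟩
  obtain ⟨m, hm⟩ := Function.ne_iff.1 hrs
  refine (Set.finite_Iic m).subset fun n hn => Set.mem_Iic.2 (not_lt.1 fun hmn => hm ?_)
  exact List.map_inj_left.1 (φ.injective hn) m (List.mem_range.2 hmn)

open Polynomial in
theorem finite_setOf_sum_inv_sub_eq_zero {k : Type*} [Field k] {s : Finset k} {β : k → k} {j : k}
    (hj : j ∈ s) (hβ : β j ≠ 0) : {x : k | ∑ α ∈ s, β α * (x - α)⁻¹ = 0}.Finite := by
  classical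
  -- Clearing denominators gives an interpolation polynomial, in barycentric form.
  let P : k[X] := Lagrange.interpolate s id fun α => (Lagrange.nodalWeight s id α)⁻¹ * β α
  have hw : ∀ α ∈ s, Lagrange.nodalWeight s id α ≠ 0 := fun α hα =>
    Lagrange.nodalWeight_ne_zero Function.injective_id.injOn hα
  have hP : P ≠ 0 := by
    intro hP
    have hPj : P.eval j = (Lagrange.nodalWeight s id j)⁻¹ * β j :=
      Lagrange.eval_interpolate_at_node _ Function.injective_id.injOn hj
    rw [hP, eval_zero] at hPj
    exact mul_ne_zero (inv_ne_zero (hw j hj)) hβ hPj.symm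
  refine (s.finite_toSet.union P.roots.toFinset.finite_toSet).subset fun x hx => ?_
  refine or_iff_not_imp_left.2 fun hxs => ?_
  have hxα : ∀ α ∈ s, x ≠ id α := fun α hα h => hxs (h ▸ hα)
  have hsum : ∑ α ∈ s, Lagrange.nodalWeight s id α * (x - id α)⁻¹ *
      ((Lagrange.nodalWeight s id α)⁻¹ * β α) = ∑ α ∈ s, β α * (x - α)⁻¹ := by
    refine Finset.sum_congr rfl fun α hα => ?_
    have := hw α hα
    simp only [id]
    field_simp
  rw [Finset.mem_coe, Multiset.mem_toFinset, mem_roots hP, IsRoot.def,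
    Lagrange.eval_interpolate_not_at_node _ hxα, hsum, hx, mul_zero]

/-- Every linear map `(C → k) → V` kills some function with only finitely many zeros. It is the
form in which the smallness of `V` enters: it follows from either bound on the dimension, for
`C = k` and `C = ℕ` respectively. -/
def KillsAlmostNonvanishing (k C V : Type*) [Field k] [AddCommGroup V] [Module k V] : Prop :=
  ∀ g : (C → k) →ₗ[k] V, ∃ u : C → k, {x | u x = 0}.Finite ∧ g u = 0

variable {k : Type v} {V : Type w} [Field k] [AddCommGroup V] [Module k V]

theorem KillsAlmostNonvanishing.of_injective {C D : Type*} (h : KillsAlmostNonvanishing k C V)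
    {φ : D → C} (hφ : Function.Injective φ) : KillsAlmostNonvanishing k D V := by
  intro g
  obtain ⟨u, hu, hgu⟩ := h (g ∘ₗ LinearMap.funLeft k k φ)
  exact ⟨u ∘ φ, hu.preimage hφ.injOn, hgu⟩

theorem killsAlmostNonvanishing_of_rank_lt_card
    (h : lift.{v} (Module.rank k V) < lift.{w} #k) : KillsAlmostNonvanishing k k V := by
  intro g
  let e : k → k → k := fun α x => (x - α)⁻¹
  have hdep : ¬ LinearIndependent k fun α => g (e α) := fun hli =>
    h.not_ge hli.cardinal_lift_le_rank
  obtain ⟨s, β, hsum, j, hj, hβ⟩ := not_linearIndependent_iff.1 hdep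
  refine ⟨∑ α ∈ s, β α • e α, ?_, by simpa using hsum⟩
  simpa [e] using finite_setOf_sum_inv_sub_eq_zero hj hβ

theorem killsAlmostNonvanishing_nat_of_card_lt [Infinite k] (h : #V < 2 ^ ℵ₀) :
    KillsAlmostNonvanishing k ℕ V := by
  intro g
  obtain ⟨e, he⟩ := exists_pairwise_finite_setOf_eq k
  have hninj : ¬ Function.Injective fun r => g (e r) := fun hinj =>
    h.not_ge (by simpa using lift_mk_le_lift_mk_of_injective hinj)
  obtain ⟨r, s, hrs, hne⟩ := Function.not_injective_iff.1 hninj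
  exact ⟨e r - e s, by simpa [sub_eq_zero] using he hne, by simpa [sub_eq_zero] using hrs⟩

theorem killsAlmostNonvanishing_nat_of_rank_lt [Infinite k] (h : Module.rank k V < 2 ^ ℵ₀) :
    KillsAlmostNonvanishing k ℕ V := by
  have hrank : lift.{v} (Module.rank k V) < 2 ^ ℵ₀ := by simpa using lift_lt.{w, v}.2 h
  rcases lt_or_ge #k (2 ^ ℵ₀) with hk | hk
  · have hcard : lift.{w} #k < 2 ^ ℵ₀ := by simpa using lift_lt.{v, w}.2 hk
    refine killsAlmostNonvanishing_nat_of_card_lt (lift_lt.{w, v}.1 ?_)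
    simpa using (lift_mk_le_max_rank k V).trans_lt (max_lt hrank hcard)
  · have hcard : 2 ^ ℵ₀ ≤ lift.{w} #k := by simpa using lift_le.{w}.2 hk
    exact (killsAlmostNonvanishing_of_rank_lt_card (hrank.trans_le hcard)).of_injective
      (Infinite.natEmbedding k).injective

end Cardinality

section Filters

theorem exists_forall_mem_eq_of_pairwise_disjoint {I ι : Type*} {X : I → Type*}
    [∀ i, Nonempty (X i)] {J : ι → Set I} (hJ : Pairwise (Function.onFun Disjoint J))
    (x : ι → ∀ i, X i) : ∃ y : ∀ i, X i, ∀ m, ∀ i ∈ J m, y i = x m i := by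
  have hex : ∀ i, ∃ t : X i, ∀ m, i ∈ J m → t = x m i := by
    intro i
    by_cases hi : ∃ m, i ∈ J m
    · obtain ⟨m, hm⟩ := hi
      exact ⟨x m i, fun l hl => by rw [hJ.eq (Set.not_disjoint_iff.2 ⟨i, hm, hl⟩)]⟩
    · exact ⟨Classical.arbitrary _, fun m hm => (hi ⟨m, hm⟩).elim⟩
  choose y hy using hex
  exact ⟨y, fun m i hi => hy i m hi⟩

theorem exists_pairwise_disjoint_mem_of_infinite {I : Type*} {s : Set (Ultrafilter I)}
    (hs : s.Infinite) : ∃ J : ℕ → Set I, Pairwise (Function.onFun Disjoint J) ∧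
      ∀ n, ∃ U ∈ s, J n ∈ U := by
  have : Infinite s := hs.to_subtype
  obtain ⟨O, hO, hopen, hdisj⟩ := exists_seq_infinite_isOpen_pairwise_disjoint s
  have hbasic : ∀ n, ∃ U : s, ∃ K ∈ U.1, ∀ W : s, K ∈ W.1 → W ∈ O n := by
    intro n
    obtain ⟨U, hU⟩ := (hO n).nonempty
    obtain ⟨T, hT, hTO⟩ := isOpen_induced_iff.1 (hopen n)
    rw [← hTO] at hU ⊢
    obtain ⟨_, ⟨K, rfl⟩, hK, hKT⟩ := ultrafilterBasis_is_basis.exists_subset_of_mem_open hU hT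
    exact ⟨U, K, hK, fun W hW => hKT hW⟩
  choose U K hK hKO using hbasic
  refine ⟨disjointed K, disjoint_disjointed K, fun n => ⟨U n, (U n).2, ?_⟩⟩
  have hlt : ∀ m < n, (K m)ᶜ ∈ (U n).1 := fun m hm =>
    Ultrafilter.compl_mem_iff_notMem.2 fun hmem =>
      Set.disjoint_left.1 (hdisj hm.ne) (hKO m _ hmem) (hKO n _ (hK n))
  rw [disjointed_eq_inter_compl]
  exact Filter.inter_mem (hK n) ((Filter.biInter_mem (Set.finite_lt_nat n)).2 hlt)

/-- Modulo `G`, every function from `I` to `C` takes finitely many values. For infinite `C`, this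
is how the completeness of all ultrafilters finer than `G`, and the finiteness of their number,
are obtained at the same time. -/
def FinitelyValued {I : Type*} (G : Filter I) (C : Type*) : Prop :=
  ∀ c : I → C, ∃ S : Set C, S.Finite ∧ c ⁻¹' S ∈ G

namespace FinitelyValued

variable {I C : Type*} {G : Filter I}

theorem of_injective {D : Type*} (h : FinitelyValued G C) {φ : D → C}
    (hφ : Function.Injective φ) : FinitelyValued G D := by
  intro c
  obtain ⟨S, hS, hG⟩ := h (φ ∘ c)
  exact ⟨φ ⁻¹' S, hS.preimage hφ.injOn, hG⟩

theorem exists_preimage_singleton_mem (h : FinitelyValued G C) {U : Ultrafilter I}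
    (hU : (U : Filter I) ≤ G) (c : I → C) : ∃ x, c ⁻¹' {x} ∈ U := by
  obtain ⟨S, hS, hG⟩ := h c
  have hmem : (⋃ x ∈ S, c ⁻¹' {x}) ∈ U := by
    rw [Set.biUnion_preimage_singleton]
    exact hU hG
  obtain ⟨x, -, hx⟩ := (Ultrafilter.finite_biUnion_mem_iff hS).1 hmem
  exact ⟨x, hx⟩

theorem finite_setOf_ultrafilter_le [Infinite C] (h : FinitelyValued G C) :
    {U : Ultrafilter I | (U : Filter I) ≤ G}.Finite := by
  by_contra hinf
  obtain ⟨J, hJ, hJU⟩ := exists_pairwise_disjoint_mem_of_infinite hinf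
  obtain ⟨c, hc⟩ := exists_forall_mem_eq_of_pairwise_disjoint hJ fun n _ => n
  obtain ⟨S, hS, hG⟩ := h.of_injective (Infinite.natEmbedding C).injective c
  obtain ⟨n, hn⟩ := hS.infinite_compl.nonempty
  obtain ⟨U, hU, hnU⟩ := hJU n
  obtain ⟨i, hiJ, hiS⟩ := U.nonempty_of_mem (Filter.inter_mem hnU (hU hG))
  exact hn (hc n i hiJ ▸ hiS)

end FinitelyValued

theorem exists_forall_preimage_singleton_notMem {I : Type*} {U : Ultrafilter I} {S : Set (Set I)}
    (hS : ∀ J ∈ S, J ∈ U) (hinter : ⋂₀ S ∉ U) : ∃ c : I → S, ∀ J, c ⁻¹' {J} ∉ U := by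
  have hne : S.Nonempty := Set.nonempty_iff_ne_empty.2 fun h =>
    hinter (by rw [h, Set.sInter_empty]; exact Filter.univ_mem)
  have : Nonempty S := hne.to_subtype
  -- Send each point outside `⋂₀ S` to a member of `S` that omits it.
  have hex : ∀ i, i ∉ ⋂₀ S → ∃ J : S, i ∉ J.1 := by simp
  choose! c hc using hex
  refine ⟨c, fun J hJ => ?_⟩
  obtain ⟨i, ⟨hcJ, hiJ⟩, hi⟩ := U.nonempty_of_mem
    (Filter.inter_mem (Filter.inter_mem hJ (hS J J.2)) (Ultrafilter.compl_mem_iff_notMem.2 hinter))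
  have hcJ : c i = J := hcJ
  exact hc i hi (hcJ ▸ hiJ)

theorem FinitelyValued.isCompleteFilter {I : Type u} {G : Filter I} {C : Type v}
    (h : FinitelyValued G C) {U : Ultrafilter I} (hU : (U : Filter I) ≤ G) :
    IsCompleteFilter (U : Filter I) (Order.succ #C) := by
  intro S hcard hS
  by_contra hinter
  obtain ⟨c, hc⟩ := exists_forall_preimage_singleton_notMem hS hinter
  rw [lift_succ, Order.lt_succ_iff, lift_mk_le'] at hcard
  obtain ⟨e⟩ := hcard
  obtain ⟨J, hJ⟩ := (h.of_injective e.injective).exists_preimage_singleton_mem hU c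
  exact hc J hJ

theorem IsCompleteFilter.map {I : Type u} {D : Type w} {F : Filter I} {κ : Cardinal.{v}}
    (hF : IsCompleteFilter F κ) (φ : I → D) : IsCompleteFilter (F.map φ) κ := by
  intro S hcard hS
  rw [Filter.mem_map, Set.preimage_sInter, ← Set.sInter_image]
  refine hF _ (lift_lt.{max u v, w}.1 ?_) (Set.forall_mem_image.2 hS)
  have himage : lift.{w} #(Set.preimage φ '' S) ≤ lift.{u} #S := mk_image_le_lift
  have hcard' := lift_lt.{max w v, u}.2 hcard
  refine lt_of_le_of_lt ?_ (hcard'.trans_eq ?_)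
  · simpa using lift_le.{v}.2 himage
  · simp

theorem isMeasurableCardinal_mk {I : Type w} {C : Type u} {U : Ultrafilter I} {c : I → C}
    (hc : ∀ x, c ⁻¹' {x} ∉ U) (hU : IsCompleteFilter (U : Filter I) #C) :
    IsMeasurableCardinal #C := by
  have hne : ∀ x, U.map c ≠ pure x := fun x hx =>
    hc x (Ultrafilter.mem_map.1 (hx ▸ Ultrafilter.mem_pure.2 rfl))
  refine ⟨?_, U.map (outMkEquiv.symm ∘ c), fun y hy => hne (outMkEquiv y) ?_, hU.map _⟩
  · by_contra hfin
    have : Finite C := lt_aleph0_iff_finite.1 (not_le.1 hfin)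
    obtain ⟨x, hx⟩ := Ultrafilter.eq_pure_of_finite (U.map c)
    exact hne x hx
  · rw [← Ultrafilter.map_pure, ← hy, Ultrafilter.map_map, ← Function.comp_assoc,
      Equiv.self_comp_symm, Function.id_comp]

theorem exists_sInter_notMem_of_forall_ne_pure {I : Type u} {U : Ultrafilter I}
    (hU : ∀ i, U ≠ pure i) :
    ∃ S : Set (Set I), (∀ J ∈ S, J ∈ U) ∧ ⋂₀ S ∉ U ∧ #S ≤ #I := by
  refine ⟨Set.range fun i => {i}ᶜ, ?_, ?_, mk_range_le⟩
  · rintro _ ⟨i, rfl⟩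
    refine Ultrafilter.compl_mem_iff_notMem.2 fun hi => hU i ?_
    exact Ultrafilter.coe_le_coe.1 (Filter.le_pure_iff.2 hi)
  · have hempty : ⋂₀ Set.range (fun i : I => ({i} : Set I)ᶜ) = ∅ := by
      ext i
      simp
    rw [hempty]
    exact U.empty_notMem

theorem exists_sInter_notMem_isCompleteFilter_mk {I : Type u} {F : Filter I} {T : Set (Set I)}
    (hT : ∀ J ∈ T, J ∈ F) (hTinter : ⋂₀ T ∉ F) :
    ∃ S : Set (Set I), (∀ J ∈ S, J ∈ F) ∧ ⋂₀ S ∉ F ∧ #S ≤ #T ∧ IsCompleteFilter F #S := by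
  let bad : Set (Set (Set I)) := {S | (∀ J ∈ S, J ∈ F) ∧ ⋂₀ S ∉ F}
  have hbad : bad.Nonempty := ⟨T, hT, hTinter⟩
  let S := Function.argminOn (fun S : Set (Set I) => #S) bad hbad
  have hmin : ∀ S' ∈ bad, #S ≤ #S' := fun S' hS' => 
    Function.argminOn_le (fun S : Set (Set I) => #S) bad hS'
  obtain ⟨hS, hSinter⟩ : S ∈ bad := Function.argminOn_mem _ bad hbad
  refine ⟨S, hS, hSinter, hmin T ⟨hT, hTinter⟩, fun S' hcard hS' => ?_⟩
  by_contra hinter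
  exact (hmin S' ⟨hS', hinter⟩).not_gt (lift_lt.1 hcard)

theorem exists_isMeasurableCardinal_le_mk {I : Type u} {U : Ultrafilter I}
    (hU : ∀ i, U ≠ pure i) {κ : Cardinal.{v}} (hκ : IsCompleteFilter (U : Filter I) κ) :
    ∃ μ : Cardinal.{u}, IsMeasurableCardinal μ ∧ lift.{u} κ ≤ lift.{v} μ ∧ μ ≤ #I := by
  obtain ⟨T, hT, hTinter, hTI⟩ := exists_sInter_notMem_of_forall_ne_pure hU
  obtain ⟨S, hS, hSinter, hST, hcomplete⟩ := exists_sInter_notMem_isCompleteFilter_mk hT hTinter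
  obtain ⟨c, hc⟩ := exists_forall_preimage_singleton_notMem hS hSinter
  refine ⟨#S, isMeasurableCardinal_mk hc hcomplete, ?_, hST.trans hTI⟩
  by_contra hlt
  exact hSinter (hκ S (not_le.1 hlt) hS)

theorem exists_finset_mem_of_forall_ultrafilter_eq_pure {I : Type*} {G : Filter I}
    (hfin : {U : Ultrafilter I | (U : Filter I) ≤ G}.Finite)
    (hpure : ∀ U : Ultrafilter I, (U : Filter I) ≤ G → ∃ i, U = pure i) :
    ∃ s : Finset I, (s : Set I) ∈ G := by
  have hs : {i : I | ((pure i : Ultrafilter I) : Filter I) ≤ G}.Finite :=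
    hfin.preimage Ultrafilter.pure_injective.injOn
  refine ⟨hs.toFinset, Filter.mem_iff_ultrafilter.2 fun U hU => ?_⟩
  obtain ⟨i, rfl⟩ := hpure U hU
  simpa using hU

theorem FinitelyValued.exists_finset_mem {I : Type u} {G : Filter I} {C : Type v} [Infinite C]
    (h : FinitelyValued G C)
    (hI : ∀ μ : Cardinal.{u}, IsMeasurableCardinal μ → lift.{u} #C < lift.{v} μ → #I < μ) :
    ∃ s : Finset I, (s : Set I) ∈ G := by
  refine exists_finset_mem_of_forall_ultrafilter_eq_pure h.finite_setOf_ultrafilter_le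
    fun U hU => ?_
  by_contra! hne
  obtain ⟨μ, hμ, hle, hμI⟩ := exists_isMeasurableCardinal_le_mk hne (h.isCompleteFilter hU)
  rw [lift_succ, Order.succ_le_iff] at hle
  exact hμI.not_gt (hI μ hμ hle)

end Filters

section Factorization

theorem exists_nonUnitalAlgHom_forall_eq_of_surjective {R A B C : Type*} [Monoid R]
    [NonUnitalNonAssocRing A] [DistribMulAction R A] [NonUnitalNonAssocRing B]
    [DistribMulAction R B] [NonUnitalNonAssocRing C] [DistribMulAction R C] {p : A →ₙₐ[R] C}
    (hp : Function.Surjective p) (h : A →ₙₐ[R] B) (hker : ∀ x, p x = 0 → h x = 0) :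
    ∃ g : C →ₙₐ[R] B, ∀ x, h x = g (p x) := by
  have hfiber : ∀ x y, p x = p y → h x = h y := fun x y hxy => by
    rw [← sub_eq_zero, ← map_sub, hker _ (by rw [map_sub, hxy, sub_self])]
  choose q hq using hp
  have hqp : ∀ x, h (q (p x)) = h x := fun x => hfiber _ _ (hq _)
  refine ⟨{ toFun := fun y => h (q y), map_smul' := fun c y => ?_, map_zero' := ?_,
            map_add' := fun y z => ?_, map_mul' := fun y z => ?_ }, fun x => (hqp x).symm⟩
  · rw [MonoidHom.id_apply, ← map_smul, ← hqp (c • q y), map_smul, hq]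
  · rw [← map_zero p, hqp, map_zero]
  · rw [← map_add, ← hqp (q y + q z), map_add, hq, hq]
  · rw [← map_mul, ← hqp (q y * q z), map_mul, hq, hq]

theorem AlgIdeal.mkHom_eq_zero_iff {k A : Type*} [CommRing k] [NonUnitalNonAssocRing A]
    [Module k A] (Z : AlgIdeal k A) {x : A} : Z.mkHom x = 0 ↔ x ∈ Z.toSubmodule :=
  Submodule.Quotient.mk_eq_zero _

variable {k : Type v} [CommRing k] {I : Type u} {A : I → Type a}
  [∀ i, NonUnitalNonAssocRing (A i)] [∀ i, Module k (A i)]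

variable (k A) in
/-- The homomorphism from `∏ A_i` to the product of its reduced products modulo the filters
`F m`. -/
def reducedProductsHom {ι : Type*} (F : ι → Filter I) :
    (∀ i, A i) →ₙₐ[k] ∀ m, ReducedProduct k A (F m) where
  toFun x m := (reducedIdeal k A (F m)).mkHom x
  map_smul' c x := funext fun _ => map_smul _ c x
  map_zero' := funext fun _ => map_zero _
  map_add' x y := funext fun _ => map_add _ x y
  map_mul' x y := funext fun _ => map_mul _ x y

theorem reducedProductsHom_surjective {ι : Type*} [Finite ι] {F : ι → Filter I}
    (hF : Pairwise (Function.onFun Disjoint F)) :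
    Function.Surjective (reducedProductsHom k A F) := by
  intro y
  obtain ⟨J, hJF, hJ⟩ := hF.exists_mem_filter_of_disjoint
  choose z hz using fun m => (reducedIdeal k A (F m)).cls_surjective (y m)
  obtain ⟨x, hx⟩ := exists_forall_mem_eq_of_pairwise_disjoint hJ z
  refine ⟨x, funext fun m => Eq.trans ?_ (hz m)⟩
  exact (reducedIdeal_mk_eq_iff k A _ _ _).2 (Filter.mem_of_superset (hJF m) (hx m))

theorem reducedProductsHom_eq_zero_iff {ι : Type*} {F : ι → Filter I} {x : ∀ i, A i} :
    reducedProductsHom k A F x = 0 ↔ ∀ᶠ i in ⨆ m, F m, x i = 0 := by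
  rw [Filter.eventually_iSup, funext_iff]
  exact forall_congr' fun m => (reducedIdeal k A (F m)).mkHom_eq_zero_iff

variable (k A) in
open Classical in
/-- The endomorphism of `∏ A_i` that replaces the components outside `J` by `0`. -/
noncomputable def truncate (J : Set I) : (∀ i, A i) →ₙₐ[k] ∀ i, A i where
  toFun x := J.piecewise x 0
  map_smul' c x := by ext i; by_cases h : i ∈ J <;> simp [h]
  map_zero' := by simp
  map_add' x y := by ext i; by_cases h : i ∈ J <;> simp [h]
  map_mul' x y := by ext i; by_cases h : i ∈ J <;> simp [h]

open Classical in
theorem truncate_of_mem {J : Set I} {i : I} (hi : i ∈ J) (x : ∀ i, A i) :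
    truncate k A J x i = x i := Set.piecewise_eq_of_mem _ _ _ hi

open Classical in
theorem truncate_of_notMem {J : Set I} {i : I} (hi : i ∉ J) (x : ∀ i, A i) :
    truncate k A J x i = 0 := Set.piecewise_eq_of_notMem _ _ _ hi

theorem truncate_congr {J : Set I} {x y : ∀ i, A i} (hxy : ∀ i ∈ J, x i = y i) :
    truncate k A J x = truncate k A J y := by
  ext i
  by_cases hi : i ∈ J
  · rw [truncate_of_mem hi, truncate_of_mem hi, hxy i hi]
  · rw [truncate_of_notMem hi, truncate_of_notMem hi]

theorem truncate_add_truncate_compl (J : Set I) (x : ∀ i, A i) :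
    truncate k A J x + truncate k A Jᶜ x = x := by
  ext i
  by_cases hi : i ∈ J
  · simp [truncate_of_mem hi, truncate_of_notMem (Set.notMem_compl_iff.2 hi)]
  · simp [truncate_of_notMem hi, truncate_of_mem (Set.mem_compl hi)]

variable {B : Type w} [NonUnitalNonAssocRing B] [Module k B]

/-- The filter of those sets `J` of indices such that `h` depends only on the components in `J`:
it kills every element of `∏ A_i` that vanishes on `J`. -/
def supportFilter (h : (∀ i, A i) →ₙₐ[k] B) : Filter I where
  sets := {J | ∀ x : ∀ i, A i, (∀ i ∈ J, x i = 0) → h x = 0}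
  univ_sets x hx := by rw [show x = 0 from funext fun i => hx i trivial, map_zero]
  sets_of_superset hJ hJK x hx := hJ x fun i hi => hx i (hJK hi)
  inter_sets := by
    intro J K hJ hK x hx
    have hxK : h (truncate k A J x) = 0 := hK _ fun i hi => by
      by_cases hiJ : i ∈ J
      · rw [truncate_of_mem hiJ, hx i ⟨hiJ, hi⟩]
      · exact truncate_of_notMem hiJ x
    have hxJ : h (truncate k A Jᶜ x) = 0 :=
      hJ _ fun i hi => truncate_of_notMem (Set.notMem_compl_iff.2 hi) x
    rw [← truncate_add_truncate_compl (k := k) J x, map_add, hxK, hxJ, add_zero]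

variable {h : (∀ i, A i) →ₙₐ[k] B}

theorem mem_supportFilter {J : Set I} :
    J ∈ supportFilter h ↔ ∀ x : ∀ i, A i, (∀ i ∈ J, x i = 0) → h x = 0 := Iff.rfl

theorem compl_mem_supportFilter {J : Set I} :
    Jᶜ ∈ supportFilter h ↔ ∀ x, h (truncate k A J x) = 0 := by
  refine ⟨fun hJ x => hJ _ fun i hi => truncate_of_notMem hi x, fun hJ x hx => ?_⟩
  have hcompl : truncate k A Jᶜ x = 0 := by
    rw [truncate_congr (y := 0) hx, map_zero]
  rw [← truncate_add_truncate_compl (k := k) J x, hcompl, add_zero, hJ]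

theorem map_eq_zero_of_eventually_supportFilter {x : ∀ i, A i}
    (hx : ∀ᶠ i in supportFilter h, x i = 0) : h x = 0 :=
  mem_supportFilter.1 hx x fun _ hi => hi

theorem factorsThroughSubproduct_iff {s : Finset I} :
    FactorsThroughSubproduct h s ↔ (s : Set I) ∈ supportFilter h := by
  constructor
  · rintro ⟨g, hg⟩ x hx
    rw [hg, show (fun i : s => x i) = 0 from funext fun i => hx i i.2, map_zero]
  · intro hs
    let p : (∀ i, A i) →ₙₐ[k] ∀ i : s, A i :=
      { toFun := fun x i => x i
        map_smul' := fun _ _ => rfl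
        map_zero' := rfl
        map_add' := fun _ _ => rfl
        map_mul' := fun _ _ => rfl }
    have hp : Function.Surjective p := Subtype.surjective_restrict _
    exact exists_nonUnitalAlgHom_forall_eq_of_surjective hp h fun x hx =>
      hs x fun i hi => congrFun hx ⟨i, hi⟩

theorem FinitelyValued.factorsThroughUltraproducts {C : Type v} [Infinite C]
    (hC : FinitelyValued (supportFilter h) C) :
    FactorsThroughUltraproducts h (Order.succ #C) := by
  obtain ⟨n, U, hUinj, hUrange⟩ := hC.finite_setOf_ultrafilter_le.fin_param
  have hU : ∀ V : Ultrafilter I, (V : Filter I) ≤ supportFilter h ↔ ∃ m, U m = V := fun V =>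
    (Set.ext_iff.1 hUrange V).symm
  have hdisj : Pairwise (Function.onFun Disjoint fun m => (U m : Filter I)) := fun l m hlm =>
    (U l).disjoint_iff_not_le.2 fun hle => hUinj.ne hlm (Ultrafilter.coe_le_coe.1 hle)
  have hsup : supportFilter h ≤ ⨆ m, (U m : Filter I) := by
    rw [← Filter.iSup_ultrafilter_le_eq (supportFilter h)]
    refine iSup₂_le fun V hV => ?_
    obtain ⟨m, rfl⟩ := (hU V).1 hV
    exact le_iSup (fun m => (U m : Filter I)) m
  refine ⟨n, U, fun m => hC.isCompleteFilter ((hU _).2 ⟨m, rfl⟩), ?_⟩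
  exact exists_nonUnitalAlgHom_forall_eq_of_surjective (reducedProductsHom_surjective hdisj) h
    fun x hx => map_eq_zero_of_eventually_supportFilter
      ((reducedProductsHom_eq_zero_iff.1 hx).filter_mono hsup)

theorem exists_eq_add_of_mem_supportFilter_mkHom_comp (Z : AlgIdeal k B)
    {f : (∀ i, A i) →ₙₐ[k] B} {s : Finset I}
    (hs : (s : Set I) ∈ supportFilter (Z.mkHom.comp f)) :
    ∃ f₁ f₀ : (∀ i, A i) →ₙₐ[k] B, FactorsThroughSubproduct f₁ s ∧
      (∀ x, f₀ x ∈ Z.toSubmodule) ∧ ∀ x, f x = f₁ x + f₀ x := by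
  refine ⟨f.comp (truncate k A s), f.comp (truncate k A (s : Set I)ᶜ),
    factorsThroughSubproduct_iff.2 fun x hx => ?_, fun x => Z.mkHom_eq_zero_iff.1 ?_, fun x => ?_⟩
  · rw [NonUnitalAlgHom.comp_apply, truncate_congr (y := 0) hx, map_zero, map_zero]
  · exact compl_mem_supportFilter.1 (by rwa [compl_compl]) x
  · rw [NonUnitalAlgHom.comp_apply, NonUnitalAlgHom.comp_apply, ← map_add,
      truncate_add_truncate_compl]

theorem finite_setOf_compl_preimage_notMem_supportFilter {C : Type*} {c : I → C}
    (hc : ∀ y, ∃ S : Set C, S.Finite ∧ ∀ J, Disjoint J (c ⁻¹' S) → h (truncate k A J y) = 0) :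
    {t | (c ⁻¹' {t})ᶜ ∉ supportFilter h}.Finite := by
  have hwitness : ∀ t, (c ⁻¹' {t})ᶜ ∉ supportFilter h →
      ∃ x, h (truncate k A (c ⁻¹' {t}) x) ≠ 0 := fun t ht => by
    simpa [compl_mem_supportFilter] using ht
  choose! w hw using hwitness
  -- The diagonal element built from the witnesses has all of them as truncations.
  obtain ⟨S, hS, hSw⟩ := hc fun i => w (c i) i
  refine hS.subset fun t ht => by_contra fun htS => hw t ht ?_
  have hdiag : truncate k A (c ⁻¹' {t}) (w t) = truncate k A (c ⁻¹' {t}) fun i => w (c i) i :=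
    truncate_congr fun i hi => by rw [show c i = t from hi]
  rw [hdiag]
  exact hSw _ ((Set.disjoint_singleton_left.2 htS).preimage c)

theorem exists_finite_preimage_mem_supportFilter {C : Type*} {c : I → C}
    (hc : ∀ y, ∃ S : Set C, S.Finite ∧ ∀ J, Disjoint J (c ⁻¹' S) → h (truncate k A J y) = 0) :
    ∃ S : Set C, S.Finite ∧ c ⁻¹' S ∈ supportFilter h := by
  let S : Set C := {t | (c ⁻¹' {t})ᶜ ∉ supportFilter h}
  refine ⟨S, finite_setOf_compl_preimage_notMem_supportFilter hc, fun x hx => ?_⟩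
  obtain ⟨T, hT, hTx⟩ := hc x
  have hmem : (⋂ t ∈ T \ S, (c ⁻¹' {t})ᶜ) ∈ supportFilter h :=
    (Filter.biInter_mem (hT.subset Set.sdiff_subset)).2 fun t ht => not_not.1 ht.2
  have hin : h (truncate k A (c ⁻¹' T) x) = 0 := by
    refine map_eq_zero_of_eventually_supportFilter ?_
    filter_upwards [hmem] with i hi
    by_cases hiT : i ∈ c ⁻¹' T
    · rw [truncate_of_mem hiT]
      exact hx i (by_contra fun hiS => Set.mem_iInter₂.1 hi (c i) ⟨hiT, hiS⟩ rfl)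
    · exact truncate_of_notMem hiT x
  have hout : h (truncate k A (c ⁻¹' T)ᶜ x) = 0 := hTx _ disjoint_compl_left
  rw [← truncate_add_truncate_compl (k := k) (c ⁻¹' T) x, map_add, hin, hout, add_zero]

end Factorization

section Surjective

variable {k : Type*} [Field k] {I : Type*} {A : I → Type*}
  [∀ i, NonUnitalNonAssocRing (A i)] [∀ i, Module k (A i)]
  [∀ i, IsScalarTower k (A i) (A i)] [∀ i, SMulCommClass k (A i) (A i)]
  {B : Type*} [NonUnitalNonAssocRing B] [Module k B] [IsScalarTower k B B] [SMulCommClass k B B]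
  {f : (∀ i, A i) →ₙₐ[k] B}

theorem map_truncate_mem_totalAnnihilator (hf : Function.Surjective f) {u : I → k}
    {y : ∀ i, A i} (huy : f (u • y) = 0) {J : Set I} (hJ : ∀ i ∈ J, u i ≠ 0) :
    f (truncate k A J y) ∈ (totalAnnihilator k B).toSubmodule := by
  intro z
  obtain ⟨b, rfl⟩ := hf z
  let b' := truncate k A J (u⁻¹ • b)
  have hleft : truncate k A J y * b = u • y * b' := by
    ext i
    by_cases hi : i ∈ J
    · simp [b', truncate_of_mem hi, smul_mul_smul_comm, hJ i hi]
    · simp [b', truncate_of_notMem hi]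
  have hright : b * truncate k A J y = b' * u • y := by
    ext i
    by_cases hi : i ∈ J
    · simp [b', truncate_of_mem hi, smul_mul_smul_comm, hJ i hi]
    · simp [b', truncate_of_notMem hi]
  constructor
  · rw [← map_mul, hleft, map_mul, huy, zero_mul]
  · rw [← map_mul, hright, map_mul, huy, mul_zero]

theorem KillsAlmostNonvanishing.exists_finite_forall_map_truncate_mem {C : Type*}
    (hC : KillsAlmostNonvanishing k C B) (hf : Function.Surjective f) (c : I → C)
    (y : ∀ i, A i) : ∃ S : Set C, S.Finite ∧ ∀ J, Disjoint J (c ⁻¹' S) →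
      f (truncate k A J y) ∈ (totalAnnihilator k B).toSubmodule := by
  let g : (C → k) →ₗ[k] B :=
    (f : (∀ i, A i) →ₗ[k] B) ∘ₗ LinearMap.pi fun i => (LinearMap.proj (c i)).smulRight (y i)
  obtain ⟨u, hu, hgu⟩ := hC g
  exact ⟨{t | u t = 0}, hu, fun J hJ => map_truncate_mem_totalAnnihilator (u := u ∘ c) hf hgu
    fun i hi => Set.disjoint_left.1 hJ hi⟩

theorem KillsAlmostNonvanishing.finitelyValued_supportFilter {C : Type*}
    (hC : KillsAlmostNonvanishing k C B) (hf : Function.Surjective f) :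
    FinitelyValued (supportFilter ((totalAnnihilator k B).mkHom.comp f)) C := by
  refine fun c => exists_finite_preimage_mem_supportFilter fun y => ?_
  obtain ⟨S, hS, hSy⟩ := hC.exists_finite_forall_map_truncate_mem hf c y
  exact ⟨S, hS, fun J hJ => (AlgIdeal.mkHom_eq_zero_iff _).2 (hSy J hJ)⟩

end Surjective

theorem theorem3p1 {k : Type v} [Field k] [Infinite k] {I : Type u} {A : I → Type a}
    [∀ i, NonUnitalNonAssocRing (A i)] [∀ i, Module k (A i)]
    [∀ i, IsScalarTower k (A i) (A i)] [∀ i, SMulCommClass k (A i) (A i)]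
    {B : Type w} [NonUnitalNonAssocRing B] [Module k B]
    [IsScalarTower k B B] [SMulCommClass k B B]
    (f : (∀ i, A i) →ₙₐ[k] B) (hf : Function.Surjective f) :
    -- case (i)
    (lift.{v} (Module.rank k B) < lift.{w} #k →
      FactorsThroughUltraproducts ((totalAnnihilator k B).mkHom.comp f) (Order.succ #k) ∧
      ((∀ μ : Cardinal.{u}, IsMeasurableCardinal μ → lift.{u} #k < lift.{v} μ → #I < μ) →
        ∃ s : Finset I, FactorsThroughSubproduct ((totalAnnihilator k B).mkHom.comp f) s ∧
          ∃ f₁ f₀ : (∀ i, A i) →ₙₐ[k] B, FactorsThroughSubproduct f₁ s ∧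
            (∀ x, f₀ x ∈ (totalAnnihilator k B).toSubmodule) ∧ ∀ x, f x = f₁ x + f₀ x)) ∧
    -- case (ii)
    (Module.rank k B < 2 ^ ℵ₀ →
      FactorsThroughUltraproducts ((totalAnnihilator k B).mkHom.comp f) ℵ₁ ∧
      ((∀ μ : Cardinal.{u}, IsMeasurableCardinal μ → ℵ₀ < μ → #I < μ) →
        ∃ s : Finset I, FactorsThroughSubproduct ((totalAnnihilator k B).mkHom.comp f) s ∧
          ∃ f₁ f₀ : (∀ i, A i) →ₙₐ[k] B, FactorsThroughSubproduct f₁ s ∧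
            (∀ x, f₀ x ∈ (totalAnnihilator k B).toSubmodule) ∧ ∀ x, f x = f₁ x + f₀ x)) := by
  refine ⟨fun hdim => ?_, fun hdim => ?_⟩
  · have hval := (killsAlmostNonvanishing_of_rank_lt_card hdim).finitelyValued_supportFilter hf
    refine ⟨hval.factorsThroughUltraproducts, fun hI => ?_⟩
    obtain ⟨s, hs⟩ := hval.exists_finset_mem hI
    exact ⟨s, factorsThroughSubproduct_iff.2 hs, exists_eq_add_of_mem_supportFilter_mkHom_comp _ hs⟩
  · have hval := ((killsAlmostNonvanishing_nat_of_rank_lt hdim).of_injective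
      Equiv.ulift.{v}.injective).finitelyValued_supportFilter hf
    refine ⟨by simpa [succ_aleph0] using hval.factorsThroughUltraproducts, fun hI => ?_⟩
    obtain ⟨s, hs⟩ := hval.exists_finset_mem (by simpa using hI)
    exact ⟨s, factorsThroughSubproduct_iff.2 hs, exists_eq_add_of_mem_supportFilter_mkHom_comp _ hs⟩
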